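/- Let $p$ be a prime and let $G$ be a $p$-adic analytic group, that is, a group which is also a finite-dimensional analytic manifold over $\mathbb{Q}_p$ such that multiplication and inversion are analytic maps. Let $k$ be a field of positive characteristic (not necessarily equal to $p$), and let $\mathrm{Rep}_k(G)$ be the category of all representations of the abstract group $G$ on $k$-vector spaces. Call $V \in \mathrm{Rep}_k(G)$ smooth if the action map $G \times V \to V$ is continuous when $V$ carries the discrete topology. Let $$0 \to V_1 \to V_2 \to V_3 \to 0$$ be a short exact sequence in $\mathrm{Rep}_k(G)$. If $V_1$ and $V_3$ are smooth, then $V_2$ is smooth. -/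

import Mathlib

open scoped Manifold ContDiff

universe u v w

/-- A representation `ρ` of a topological group `G` on a `k`-module `V` is *smooth* if the action
map `G × V → V`, `(g, v) ↦ ρ g v`, is continuous when `V` carries the discrete topology (and
`G × V` the product topology). -/
def Representation.IsSmooth {k G V : Type*} [CommSemiring k] [Group G] [TopologicalSpace G]
    [AddCommMonoid V] [Module k V] (ρ : Representation k G V) : Prop :=
  letI : TopologicalSpace V := ⊥
  Continuous fun x : G × V => ρ x.1 x.2

/-!
Let `q = p * ringChar k`, so that `q` is zero in `k` while `g ^ q ^ m → 1` for `g` near `1` in `G`.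
In a chart centered at `1` the product is `x + y + O(‖x‖ ‖y‖)`. Hence, if the `a i` are small
elements on the coordinate axes, then the closures of the groups `⟨a i ^ q ^ m⟩` generate an open
subgroup for every `m`.

Smoothness means that all vectors have open stabilizers. Given `v : V₂`, take the `a i` in the
stabilizer of the image of `v` in `V₃`. For `y` in the closure of `⟨a i⟩`, the vector `ρ y v - v`
comes from `V₁`, hence has an open stabilizer. If `y` and `z` commute, then `y` fixes `ρ z v - v`
exactly if `z` fixes `ρ y v - v`. For `h = a i ^ q ^ m` with `m` large it follows that every `y` in
the closure of `⟨h⟩` fixes `ρ y v - v`, so that `ρ (y ^ q) v = v + q • (ρ y v - v) = v`. So the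
closures of the groups `⟨a i ^ q ^ (m + 1)⟩`, and the open subgroup they generate, fix `v`.
-/

open Filter Topology

section Ultrametric

variable {F : Type*} [SeminormedAddCommGroup F] [IsUltrametricDist F] {c : ℝ}

theorem norm_add_le_of_norm_le_of_norm_le {x y : F} (hx : ‖x‖ ≤ c) (hy : ‖y‖ ≤ c) :
    ‖x + y‖ ≤ c :=
  (IsUltrametricDist.norm_add_le_max x y).trans (max_le hx hy)

theorem norm_le_of_norm_sub_le {x y : F} (hxy : ‖x - y‖ ≤ c) (hy : ‖y‖ ≤ c) : ‖x‖ ≤ c := by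
  simpa only [sub_add_cancel] using norm_add_le_of_norm_le_of_norm_le hxy hy

theorem norm_sub_le_of_norm_sub_le {x y z : F} (hxy : ‖x - y‖ ≤ c) (hyz : ‖y - z‖ ≤ c) :
    ‖x - z‖ ≤ c := by
  simpa only [sub_add_sub_cancel] using norm_add_le_of_norm_le_of_norm_le hxy hyz

end Ultrametric

/-- A map `φ` from a group to a normed group is *almost additive* on a subgroup `U`, with relative
error `ε`, if `φ (g * h)` agrees with `φ g + φ h` up to an error which is small compared with both
terms. This is the trace left on norms by the expansion `x + y + O(‖x‖ ‖y‖)` of a group law in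
local coordinates at the identity. -/
def AlmostAdditiveOn {G F : Type*} [Group G] [NormedAddCommGroup F] (φ : G → F) (U : Subgroup G)
    (ε : ℝ) : Prop :=
  ∀ g ∈ U, ∀ h ∈ U, ‖φ (g * h) - φ g - φ h‖ ≤ ε * min ‖φ g‖ ‖φ h‖

namespace AlmostAdditiveOn

section Group

variable {G F : Type*} [Group G] [NormedAddCommGroup F] {φ : G → F} {U : Subgroup G} {ε : ℝ}

theorem norm_map_mul_sub_le_left (hφ : AlmostAdditiveOn φ U ε) (hε₀ : 0 ≤ ε) {g h : G}
    (hg : g ∈ U) (hh : h ∈ U) : ‖φ (g * h) - φ g - φ h‖ ≤ ε * ‖φ g‖ :=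
  (hφ g hg h hh).trans (by gcongr; exact min_le_left _ _)

theorem norm_map_mul_sub_le_right (hφ : AlmostAdditiveOn φ U ε) (hε₀ : 0 ≤ ε) {g h : G}
    (hg : g ∈ U) (hh : h ∈ U) : ‖φ (g * h) - φ g - φ h‖ ≤ ε * ‖φ h‖ :=
  (hφ g hg h hh).trans (by gcongr; exact min_le_right _ _)

theorem map_one (hφ : AlmostAdditiveOn φ U ε) (hε : ε < 1) : φ 1 = 0 := by
  have h : ‖φ 1‖ ≤ ε * ‖φ 1‖ := by simpa using hφ 1 U.one_mem 1 U.one_mem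
  exact norm_le_zero_iff.1 (by nlinarith [norm_nonneg (φ 1)])

variable [IsUltrametricDist F]

theorem norm_map_inv_mul (hφ : AlmostAdditiveOn φ U ε) (hε₀ : 0 ≤ ε) (hε : ε < 1) {g h : G}
    (hg : g ∈ U) (hh : h ∈ U) : ‖φ (g⁻¹ * h)‖ = ‖φ h - φ g‖ := by
  set w := g⁻¹ * h
  have hsub : ‖φ h - φ g - φ w‖ ≤ ε * ‖φ w‖ := by
    simpa [w] using hφ.norm_map_mul_sub_le_right hε₀ hg (U.mul_mem (U.inv_mem hg) hh)
  rcases (norm_nonneg (φ w)).eq_or_lt with hw | hw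
  · rw [← hw, mul_zero, norm_le_zero_iff, sub_eq_zero] at hsub
    rw [hsub]
  · have hlt : ‖φ h - φ g - φ w‖ < ‖φ w‖ := hsub.trans_lt (mul_lt_of_lt_one_left hw hε)
    have h := IsUltrametricDist.norm_eq_of_add_norm_lt_max (x := φ h - φ g) (y := -φ w)
    rw [← sub_eq_add_neg, norm_neg] at h
    exact (h (lt_max_of_lt_right hlt)).symm

theorem norm_map_mul_left_sub_le (hφ : AlmostAdditiveOn φ U ε) (hε₀ : 0 ≤ ε) (hε : ε < 1)
    {x g h : G} (hx : x ∈ U) (hg : g ∈ U) (hh : h ∈ U) :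
    ‖φ (x * h) - φ (x * g) - (φ h - φ g)‖ ≤ ε * ‖φ h - φ g‖ := by
  have hw : g⁻¹ * h ∈ U := U.mul_mem (U.inv_mem hg) hh
  have h₁ := hφ.norm_map_mul_sub_le_right hε₀ (U.mul_mem hx hg) hw
  have h₂ := hφ.norm_map_mul_sub_le_right hε₀ hg hw
  rw [hφ.norm_map_inv_mul hε₀ hε hg hh] at h₁ h₂
  rw [mul_assoc, mul_inv_cancel_left] at h₁
  rw [mul_inv_cancel_left, norm_sub_rev] at h₂
  exact norm_sub_le_of_norm_sub_le h₁ h₂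

theorem norm_map_list_prod_mul_sub_le (hφ : AlmostAdditiveOn φ U ε) (hε₀ : 0 ≤ ε) (hε : ε < 1)
    {ι : Type*} {x y : ι → G} (hx : ∀ i, x i ∈ U) (hy : ∀ i, y i ∈ U) {c : ℝ} (hc : 0 ≤ c)
    (hyc : ∀ i, ‖φ (y i)‖ ≤ c) (l : List ι) :
    ‖φ (l.map fun i => x i * y i).prod - φ (l.map x).prod - (l.map fun i => φ (y i)).sum‖ ≤
      ε * c := by
  induction l with
  | nil => simpa using mul_nonneg hε₀ hc
  | cons i l ih =>
    simp only [List.map_cons, List.prod_cons, List.sum_cons, mul_assoc]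
    set T := (l.map x).prod
    set T' := (l.map fun i => x i * y i).prod
    set s := (l.map fun i => φ (y i)).sum
    have hT : T ∈ U := list_prod_mem (by simp [hx])
    have hT' : T' ∈ U := list_prod_mem (by simp [hx, hy, U.mul_mem])
    have hs : ‖s‖ ≤ c :=
      List.sum_induction (‖·‖ ≤ c) (fun _ _ => norm_add_le_of_norm_le_of_norm_le) (by simpa)
        (by simp [hyc])
    have hmul : ‖φ (y i * T') - φ T - (φ (y i) + s)‖ ≤ ε * c := by
      have h := hφ.norm_map_mul_sub_le_left hε₀ (hy i) hT'
      refine (congrArg norm ?_).trans_le (norm_add_le_of_norm_le_of_norm_le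
        (h.trans (mul_le_mul_of_nonneg_left (hyc i) hε₀)) ih)
      abel
    have hdiff : ‖φ (y i * T') - φ T‖ ≤ c :=
      norm_le_of_norm_sub_le (hmul.trans (mul_le_of_le_one_left hc hε.le))
        (norm_add_le_of_norm_le_of_norm_le (hyc i) hs)
    have htrans := (hφ.norm_map_mul_left_sub_le hε₀ hε (hx i) hT (U.mul_mem (hy i) hT')).trans
      (mul_le_mul_of_nonneg_left hdiff hε₀)
    exact norm_sub_le_of_norm_sub_le htrans hmul

theorem norm_map_pow_sub_nsmul_le (hφ : AlmostAdditiveOn φ U ε) (hε₀ : 0 ≤ ε) (hε : ε < 1) {g : G}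
    (hg : g ∈ U) (a : ℕ) : ‖φ (g ^ a) - a • φ g‖ ≤ ε * ‖φ g‖ := by
  induction a with
  | zero => simpa [hφ.map_one hε] using mul_nonneg hε₀ (norm_nonneg _)
  | succ a ih =>
    have h := hφ.norm_map_mul_sub_le_right hε₀ (U.pow_mem hg a) hg
    rw [← pow_succ] at h
    refine (congrArg norm ?_).trans_le (norm_add_le_of_norm_le_of_norm_le h ih)
    rw [succ_nsmul]
    abel

theorem norm_map_pow_le (hφ : AlmostAdditiveOn φ U ε) (hε₀ : 0 ≤ ε) (hε : ε < 1) {g : G}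
    (hg : g ∈ U) (a : ℕ) : ‖φ (g ^ a)‖ ≤ ‖φ g‖ :=
  norm_le_of_norm_sub_le ((hφ.norm_map_pow_sub_nsmul_le hε₀ hε hg a).trans
    (mul_le_of_le_one_left (norm_nonneg _) hε.le)) (IsUltrametricDist.norm_nsmul_le _ _)

end Group

section NormedSpace

variable {G 𝕜 F : Type*} [Group G] [NormedField 𝕜] [NormedAddCommGroup F] [NormedSpace 𝕜 F]
  [IsUltrametricDist F] {φ : G → F} {U : Subgroup G} {q : ℕ}

theorem norm_map_pow_natCast_sub_smul_le (hφ : AlmostAdditiveOn φ U (‖(q : 𝕜)‖ ^ 2))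
    (hq : ‖(q : 𝕜)‖ < 1) {g : G} (hg : g ∈ U) :
    ‖φ (g ^ q) - (q : 𝕜) • φ g‖ ≤ ‖(q : 𝕜)‖ ^ 2 * ‖φ g‖ := by
  rw [Nat.cast_smul_eq_nsmul]
  exact hφ.norm_map_pow_sub_nsmul_le (by positivity) (pow_lt_one₀ (norm_nonneg _) hq two_ne_zero)
    hg q

theorem norm_map_pow_pow_le (hφ : AlmostAdditiveOn φ U (‖(q : 𝕜)‖ ^ 2)) (hq : ‖(q : 𝕜)‖ < 1)
    {g : G} (hg : g ∈ U) (m : ℕ) : ‖φ (g ^ q ^ m)‖ ≤ ‖(q : 𝕜)‖ ^ m * ‖φ g‖ := by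
  induction m with
  | zero => simp
  | succ m ih =>
    have hstep : ‖φ (g ^ q ^ (m + 1))‖ ≤ ‖(q : 𝕜)‖ * ‖φ (g ^ q ^ m)‖ := by
      rw [pow_succ, pow_mul]
      refine norm_le_of_norm_sub_le
        ((hφ.norm_map_pow_natCast_sub_smul_le hq (U.pow_mem hg _)).trans ?_) (norm_smul _ _).le
      gcongr
      exact pow_le_of_le_one (norm_nonneg _) hq.le two_ne_zero
    calc ‖φ (g ^ q ^ (m + 1))‖ ≤ ‖(q : 𝕜)‖ * (‖(q : 𝕜)‖ ^ m * ‖φ g‖) := hstep.trans (by gcongr)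
      _ = ‖(q : 𝕜)‖ ^ (m + 1) * ‖φ g‖ := by ring

theorem norm_map_pow_pow_sub_smul_le (hφ : AlmostAdditiveOn φ U (‖(q : 𝕜)‖ ^ 2))
    (hq : ‖(q : 𝕜)‖ < 1) {g : G} (hg : g ∈ U) (m : ℕ) :
    ‖φ (g ^ q ^ m) - (q : 𝕜) ^ m • φ g‖ ≤ ‖(q : 𝕜)‖ ^ (m + 1) * ‖φ g‖ := by
  induction m with
  | zero => simp [mul_nonneg]
  | succ m ih =>
    have hpow : ‖φ (g ^ q ^ (m + 1)) - (q : 𝕜) • φ (g ^ q ^ m)‖ ≤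
        ‖(q : 𝕜)‖ ^ (m + 1 + 1) * ‖φ g‖ := by
      rw [pow_succ q, pow_mul]
      calc _ ≤ ‖(q : 𝕜)‖ ^ 2 * (‖(q : 𝕜)‖ ^ m * ‖φ g‖) :=
            (hφ.norm_map_pow_natCast_sub_smul_le hq (U.pow_mem hg _)).trans
              (by gcongr; exact hφ.norm_map_pow_pow_le hq hg m)
        _ = _ := by ring
    have hsmul : ‖(q : 𝕜) • φ (g ^ q ^ m) - (q : 𝕜) ^ (m + 1) • φ g‖ ≤
        ‖(q : 𝕜)‖ ^ (m + 1 + 1) * ‖φ g‖ := by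
      rw [pow_succ', mul_smul, ← smul_sub, norm_smul, pow_succ', mul_assoc]
      gcongr
    exact norm_sub_le_of_norm_sub_le hpow hsmul

theorem norm_map_pow_pow_pow_sub_nsmul_le (hφ : AlmostAdditiveOn φ U (‖(q : 𝕜)‖ ^ 2))
    (hq : ‖(q : 𝕜)‖ < 1) {g : G} (hg : g ∈ U) (m a : ℕ) :
    ‖φ ((g ^ q ^ m) ^ a) - a • (q : 𝕜) ^ m • φ g‖ ≤ ‖(q : 𝕜)‖ ^ (m + 1) * ‖φ g‖ := by
  have hε : ‖(q : 𝕜)‖ ^ 2 ≤ ‖(q : 𝕜)‖ := pow_le_of_le_one (norm_nonneg _) hq.le two_ne_zero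
  have hpow : ‖φ ((g ^ q ^ m) ^ a) - a • φ (g ^ q ^ m)‖ ≤ ‖(q : 𝕜)‖ ^ (m + 1) * ‖φ g‖ :=
    calc _ ≤ ‖(q : 𝕜)‖ ^ 2 * ‖φ (g ^ q ^ m)‖ :=
          hφ.norm_map_pow_sub_nsmul_le (by positivity) (hε.trans_lt hq) (U.pow_mem hg _) a
      _ ≤ ‖(q : 𝕜)‖ * (‖(q : 𝕜)‖ ^ m * ‖φ g‖) := by
          gcongr
          exact hφ.norm_map_pow_pow_le hq hg m
      _ = ‖(q : 𝕜)‖ ^ (m + 1) * ‖φ g‖ := by ring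
  have hsmul : ‖a • φ (g ^ q ^ m) - a • (q : 𝕜) ^ m • φ g‖ ≤ ‖(q : 𝕜)‖ ^ (m + 1) * ‖φ g‖ := by
    rw [← nsmul_sub]
    exact (IsUltrametricDist.norm_nsmul_le _ _).trans (hφ.norm_map_pow_pow_sub_smul_le hq hg m)
  exact norm_sub_le_of_norm_sub_le hpow hsmul

end NormedSpace

end AlmostAdditiveOn

section PadicApproximation

variable {p q : ℕ} [Fact p.Prime]

theorem exists_norm_natCast_mul_pow_sub_le (hq : q ≠ 0) {n : ℕ} {x : ℚ_[p]}
    (hx : ‖x‖ ≤ ‖(q : ℚ_[p])‖ ^ n) :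
    ∃ a : ℕ, ‖a * (q : ℚ_[p]) ^ n - x‖ ≤ ‖(q : ℚ_[p])‖ ^ (n + 1) := by
  have hq' : (q : ℚ_[p]) ≠ 0 := Nat.cast_ne_zero.2 hq
  have hr : 0 < ‖(q : ℚ_[p])‖ := norm_pos_iff.2 hq'
  have hy : ‖x / (q : ℚ_[p]) ^ n‖ ≤ 1 := by rwa [norm_div, norm_pow, div_le_one (by positivity)]
  obtain ⟨y, hyx⟩ : ∃ y : ℤ_[p], (y : ℚ_[p]) = x / (q : ℚ_[p]) ^ n := ⟨⟨_, hy⟩, rfl⟩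
  obtain ⟨a, ha⟩ := PadicInt.denseRange_natCast.exists_dist_lt y hr
  refine ⟨a, ?_⟩
  have ha' : ‖a - x / (q : ℚ_[p]) ^ n‖ < ‖(q : ℚ_[p])‖ := by
    rwa [dist_eq_norm, norm_sub_rev, PadicInt.norm_def, PadicInt.coe_sub,
      PadicInt.coe_natCast, hyx] at ha
  calc ‖a * (q : ℚ_[p]) ^ n - x‖ = ‖a - x / (q : ℚ_[p]) ^ n‖ * ‖(q : ℚ_[p])‖ ^ n := by
        rw [← norm_pow, ← norm_mul, sub_mul, div_mul_cancel₀ _ (pow_ne_zero n hq')]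
    _ ≤ ‖(q : ℚ_[p])‖ ^ (n + 1) := by
        rw [pow_succ']
        gcongr

variable {ι : Type*} [Fintype ι] [DecidableEq ι]

theorem exists_norm_sum_nsmul_single_sub_le (hq : q ≠ 0) {n : ℕ} {x : ι → ℚ_[p]}
    (hx : ‖x‖ ≤ ‖(q : ℚ_[p])‖ ^ n) :
    ∃ a : ι → ℕ, ‖∑ i, a i • Pi.single i ((q : ℚ_[p]) ^ n) - x‖ ≤ ‖(q : ℚ_[p])‖ ^ (n + 1) := by
  choose a ha using fun i =>
    exists_norm_natCast_mul_pow_sub_le hq ((norm_le_pi_norm x i).trans hx)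
  refine ⟨a, (pi_norm_le_iff_of_nonneg (by positivity)).2 fun i => ?_⟩
  simpa [Finset.sum_apply, Pi.single_apply] using ha i

namespace AlmostAdditiveOn

variable {G : Type*} [Group G] {φ : G → ι → ℚ_[p]} {U : Subgroup G} {M : ℕ} {a : ι → G}

theorem exists_norm_sum_map_pow_pow_pow_sub_le (hφ : AlmostAdditiveOn φ U (‖(q : ℚ_[p])‖ ^ 2))
    (hq : q ≠ 0) (hq₁ : ‖(q : ℚ_[p])‖ < 1) (ha : ∀ i, a i ∈ U)
    (haM : ∀ i, φ (a i) = Pi.single i ((q : ℚ_[p]) ^ M)) {n : ℕ} {x : ι → ℚ_[p]}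
    (hx : ‖x‖ ≤ ‖(q : ℚ_[p])‖ ^ (M + n)) :
    ∃ f : ι → ℕ, ‖∑ i, φ ((a i ^ q ^ n) ^ f i) - x‖ ≤ ‖(q : ℚ_[p])‖ ^ (M + n + 1) := by
  obtain ⟨f, hf⟩ := exists_norm_sum_nsmul_single_sub_le hq hx
  refine ⟨f, norm_sub_le_of_norm_sub_le ?_ hf⟩
  rw [← Finset.sum_sub_distrib]
  refine IsUltrametricDist.norm_sum_le_of_forall_le_of_nonneg (by positivity) fun i _ => ?_
  have h := hφ.norm_map_pow_pow_pow_sub_nsmul_le hq₁ (ha i) n (f i)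
  rwa [haM, ← Pi.single_smul, Pi.norm_single, norm_pow, ← pow_add, smul_eq_mul, ← pow_add,
    add_comm n M, add_right_comm n 1 M, add_comm n M] at h

theorem exists_norm_map_prod_mul_pow_sub_le (hφ : AlmostAdditiveOn φ U (‖(q : ℚ_[p])‖ ^ 2))
    (hq : q ≠ 0) (hq₁ : ‖(q : ℚ_[p])‖ < 1) (ha : ∀ i, a i ∈ U)
    (haM : ∀ i, φ (a i) = Pi.single i ((q : ℚ_[p]) ^ M)) {n : ℕ} {g : G} (hg : g ∈ U)
    {x : ι → G} (hx : ∀ i, x i ∈ U)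
    (hxg : ‖φ (Finset.univ.toList.map x).prod - φ g‖ ≤ ‖(q : ℚ_[p])‖ ^ (M + n)) :
    ∃ f : ι → ℕ, ‖φ (Finset.univ.toList.map fun i => x i * (a i ^ q ^ n) ^ f i).prod - φ g‖ ≤
      ‖(q : ℚ_[p])‖ ^ (M + n + 1) := by
  have hε : ‖(q : ℚ_[p])‖ ^ 2 < 1 := pow_lt_one₀ (norm_nonneg _) hq₁ two_ne_zero
  set w := (Finset.univ.toList.map x).prod
  have hw : w ∈ U := list_prod_mem (by simp [hx])
  have hu : ‖φ (w⁻¹ * g)‖ ≤ ‖(q : ℚ_[p])‖ ^ (M + n) := by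
    rwa [hφ.norm_map_inv_mul (by positivity) hε hw hg, norm_sub_rev]
  obtain ⟨f, hf⟩ := hφ.exists_norm_sum_map_pow_pow_pow_sub_le hq hq₁ ha haM hu
  refine ⟨f, ?_⟩
  set y : ι → G := fun i => (a i ^ q ^ n) ^ f i
  have hy : ∀ i, y i ∈ U := fun i => U.pow_mem (U.pow_mem (ha i) _) _
  have hyn : ∀ i, ‖φ (y i)‖ ≤ ‖(q : ℚ_[p])‖ ^ (M + n) := fun i =>
    calc ‖φ (y i)‖ ≤ ‖φ (a i ^ q ^ n)‖ :=
          hφ.norm_map_pow_le (by positivity) hε (U.pow_mem (ha i) _) (f i)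
      _ ≤ ‖(q : ℚ_[p])‖ ^ n * ‖φ (a i)‖ := hφ.norm_map_pow_pow_le hq₁ (ha i) _
      _ = ‖(q : ℚ_[p])‖ ^ (M + n) := by
          rw [haM, Pi.norm_single, norm_pow, ← pow_add, add_comm]
  have herror : ‖(q : ℚ_[p])‖ ^ 2 * ‖(q : ℚ_[p])‖ ^ (M + n) ≤ ‖(q : ℚ_[p])‖ ^ (M + n + 1) := by
    rw [← pow_add]
    exact pow_le_pow_of_le_one (norm_nonneg _) hq₁.le (by lia)
  have hprod : ‖φ (Finset.univ.toList.map fun i => x i * y i).prod - φ w - ∑ i, φ (y i)‖ ≤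
      ‖(q : ℚ_[p])‖ ^ (M + n + 1) := by
    rw [← Finset.sum_map_toList]
    exact (hφ.norm_map_list_prod_mul_sub_le (by positivity) hε hx hy (by positivity) hyn _).trans
      herror
  have hsplit : ‖φ w + φ (w⁻¹ * g) - φ g‖ ≤ ‖(q : ℚ_[p])‖ ^ (M + n + 1) := by
    have h := hφ.norm_map_mul_sub_le_right (by positivity) hw (U.mul_mem (U.inv_mem hw) hg)
    rw [mul_inv_cancel_left, sub_sub, norm_sub_rev] at h
    exact h.trans (le_trans (by gcongr) herror)
  refine (congrArg norm ?_).trans_le (norm_add_le_of_norm_le_of_norm_le hprod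
    (norm_add_le_of_norm_le_of_norm_le hf hsplit))
  abel

theorem exists_norm_map_prod_pow_pow_pow_sub_le
    (hφ : AlmostAdditiveOn φ U (‖(q : ℚ_[p])‖ ^ 2)) (hq : q ≠ 0) (hq₁ : ‖(q : ℚ_[p])‖ < 1)
    (ha : ∀ i, a i ∈ U) (haM : ∀ i, φ (a i) = Pi.single i ((q : ℚ_[p]) ^ M)) {m : ℕ} {g : G}
    (hg : g ∈ U) (hgm : ‖φ g‖ ≤ ‖(q : ℚ_[p])‖ ^ (M + m)) (n : ℕ) :
    ∃ e : ι → ℕ, ‖φ (Finset.univ.toList.map fun i => (a i ^ q ^ m) ^ e i).prod - φ g‖ ≤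
      ‖(q : ℚ_[p])‖ ^ (M + m + n) := by
  induction n with
  | zero =>
    exact ⟨0, by simpa [hφ.map_one (pow_lt_one₀ (norm_nonneg _) hq₁ two_ne_zero)] using hgm⟩
  | succ n ih =>
    obtain ⟨e, he⟩ := ih
    rw [add_assoc] at he
    obtain ⟨f, hf⟩ := hφ.exists_norm_map_prod_mul_pow_sub_le hq hq₁ ha haM hg
      (fun i => U.pow_mem (U.pow_mem (ha i) _) _) he
    refine ⟨fun i => e i + q ^ n * f i, ?_⟩
    simpa only [pow_add _ (e _), pow_mul, pow_add q, add_assoc] using hf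

end AlmostAdditiveOn

end PadicApproximation

/-- A *standard subgroup* for a chart `φ` of a topological group: a compact open subgroup inside
the domain of `φ` on which the group law is addition of coordinates, up to relative error `ε`. -/
structure IsStandardSubgroup {G F : Type*} [Group G] [TopologicalSpace G] [NormedAddCommGroup F]
    (φ : OpenPartialHomeomorph G F) (U : Subgroup G) (ε : ℝ) : Prop where
  isOpen : IsOpen (U : Set G)
  isCompact : IsCompact (U : Set G)
  subset_source : (U : Set G) ⊆ φ.source
  almostAdditiveOn : AlmostAdditiveOn φ U ε

/-- A topological group *has procyclic generators* with respect to `q` if, inside every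
neighborhood of `1`, there are finitely many elements `a i` topologically generating compact
subgroups, with `a i ^ q ^ m → 1`, such that for each `m` the closures of the subgroups generated
by the `a i ^ q ^ m` together generate an open subgroup. -/
def HasProcyclicGenerators (q : ℕ) (G : Type*) [Group G] [TopologicalSpace G]
    [IsTopologicalGroup G] : Prop :=
  ∀ K ∈ 𝓝 (1 : G), ∃ (d : ℕ) (a : Fin d → G),
    (∀ i, a i ∈ K ∧ IsCompact ((Subgroup.zpowers (a i)).topologicalClosure : Set G) ∧
      Tendsto (fun m => a i ^ q ^ m) atTop (𝓝 1)) ∧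
    ∀ m, IsOpen ((⨆ i, (Subgroup.zpowers (a i ^ q ^ m)).topologicalClosure : Subgroup G) : Set G)

namespace IsStandardSubgroup

variable {G : Type*} [Group G] [TopologicalSpace G]

section NormedGroup

variable {F : Type*} [NormedAddCommGroup F] {φ : OpenPartialHomeomorph G F} {U : Subgroup G}
  {ε : ℝ}

theorem topologicalClosure_zpowers_le [IsTopologicalGroup G] (hU : IsStandardSubgroup φ U ε)
    {g : G} (hg : g ∈ U) : (Subgroup.zpowers g).topologicalClosure ≤ U :=
  Subgroup.topologicalClosure_minimal _ (Subgroup.zpowers_le.2 hg)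
    (U.isClosed_of_isOpen hU.isOpen)

theorem isCompact_topologicalClosure_zpowers [IsTopologicalGroup G]
    (hU : IsStandardSubgroup φ U ε) {g : G} (hg : g ∈ U) :
    IsCompact ((Subgroup.zpowers g).topologicalClosure : Set G) :=
  hU.isCompact.of_isClosed_subset (Subgroup.isClosed_topologicalClosure _)
    (hU.topologicalClosure_zpowers_le hg)

theorem mem_nhds_one (hU : IsStandardSubgroup φ U ε) : (U : Set G) ∈ 𝓝 1 :=
  hU.isOpen.mem_nhds U.one_mem

theorem one_mem_source (hU : IsStandardSubgroup φ U ε) : 1 ∈ φ.source :=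
  hU.subset_source U.one_mem

theorem tendsto_nhds_one (hU : IsStandardSubgroup φ U ε) (hε : ε < 1) {g : ℕ → G}
    (hg : ∀ n, g n ∈ U) (h : Tendsto (fun n => φ (g n)) atTop (𝓝 0)) :
    Tendsto g atTop (𝓝 1) := by
  rw [φ.nhds_eq_comap_inf_principal hU.one_mem_source, hU.almostAdditiveOn.map_one hε,
    tendsto_inf, tendsto_comap_iff, tendsto_principal]
  exact ⟨h, Eventually.of_forall fun n => hU.subset_source (hg n)⟩

theorem exists_map_eq_of_norm_le (hU : IsStandardSubgroup φ U ε) (hε : ε < 1) {K : Set G}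
    (hK : K ∈ 𝓝 1) {r : ℝ} (hr : r < 1) :
    ∃ M : ℕ, ∀ x : F, ‖x‖ ≤ r ^ M → ∃ g ∈ U, g ∈ K ∧ φ g = x := by
  have himage : φ '' (U ∩ K) ∈ 𝓝 (0 : F) := by
    rw [← hU.almostAdditiveOn.map_one hε]
    exact φ.image_mem_nhds hU.one_mem_source (inter_mem hU.mem_nhds_one hK)
  obtain ⟨δ, hδ, hball⟩ := Metric.mem_nhds_iff.1 himage
  obtain ⟨M, hM⟩ := exists_pow_lt_of_lt_one hδ hr
  refine ⟨M, fun x hx => ?_⟩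
  obtain ⟨g, ⟨hgU, hgK⟩, rfl⟩ := hball (mem_ball_zero_iff.2 (hx.trans_lt hM))
  exact ⟨g, hgU, hgK, rfl⟩

end NormedGroup

variable [IsTopologicalGroup G] {p q : ℕ} [Fact p.Prime] {U : Subgroup G}

theorem mem_iSup_topologicalClosure_zpowers {ι : Type*} [Fintype ι] [DecidableEq ι]
    {φ : OpenPartialHomeomorph G (ι → ℚ_[p])} (hU : IsStandardSubgroup φ U (‖(q : ℚ_[p])‖ ^ 2))
    (hq : q ≠ 0) (hq₁ : ‖(q : ℚ_[p])‖ < 1) {M m : ℕ} {a : ι → G} (ha : ∀ i, a i ∈ U)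
    (haM : ∀ i, φ (a i) = Pi.single i ((q : ℚ_[p]) ^ M)) {g : G} (hg : g ∈ U)
    (hgm : ‖φ g‖ ≤ ‖(q : ℚ_[p])‖ ^ (M + m)) :
    g ∈ ⨆ i, (Subgroup.zpowers (a i ^ q ^ m)).topologicalClosure := by
  set C : ι → Subgroup G := fun i => (Subgroup.zpowers (a i ^ q ^ m)).topologicalClosure
  have ham : ∀ i, a i ^ q ^ m ∈ U := fun i => U.pow_mem (ha i) _
  set P : Set G := (fun x : ι → G => (Finset.univ.toList.map x).prod) ''
    Set.univ.pi fun i => (C i : Set G)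
  have hP : IsCompact P :=
    (isCompact_univ_pi fun i => hU.isCompact_topologicalClosure_zpowers (ham i)).image
      (continuous_list_prod _ fun i _ => continuous_apply i)
  have hPU : P ⊆ U := by
    rintro _ ⟨x, hx, rfl⟩
    have hxU : ∀ i, x i ∈ U := fun i =>
      hU.topologicalClosure_zpowers_le (ham i) (hx i (Set.mem_univ i))
    exact list_prod_mem (by simp [hxU])
  have hclosed : IsClosed (φ '' P) :=
    (hP.image_of_continuousOn (φ.continuousOn.mono (hPU.trans hU.subset_source))).isClosed
  have hmem : φ g ∈ φ '' P := by
    rw [← hclosed.closure_eq, Metric.mem_closure_iff]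
    intro δ hδ
    obtain ⟨n, hn⟩ := exists_pow_lt_of_lt_one hδ hq₁
    obtain ⟨e, he⟩ :=
      hU.almostAdditiveOn.exists_norm_map_prod_pow_pow_pow_sub_le hq hq₁ ha haM hg hgm n
    refine ⟨_, ⟨_, ⟨fun i => (a i ^ q ^ m) ^ e i, fun i _ => ?_, rfl⟩, rfl⟩, ?_⟩
    · exact Subgroup.le_topologicalClosure _ (Subgroup.npow_mem_zpowers _ _)
    · rw [dist_comm, dist_eq_norm]
      exact (he.trans (pow_le_pow_of_le_one (norm_nonneg _) hq₁.le (by lia))).trans_lt hn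
  obtain ⟨_, ⟨x, hx, rfl⟩, hxg⟩ := hmem
  rw [← φ.injOn (hU.subset_source (hPU ⟨x, hx, rfl⟩)) (hU.subset_source hg) hxg]
  exact list_prod_mem (by simpa using fun i => le_iSup C i (hx i (Set.mem_univ i)))

theorem hasProcyclicGenerators {d : ℕ} {φ : OpenPartialHomeomorph G (Fin d → ℚ_[p])}
    (hU : IsStandardSubgroup φ U (‖(q : ℚ_[p])‖ ^ 2)) (hq : q ≠ 0) (hq₁ : ‖(q : ℚ_[p])‖ < 1) :
    HasProcyclicGenerators q G := by
  intro K hK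
  have hε : ‖(q : ℚ_[p])‖ ^ 2 < 1 := pow_lt_one₀ (norm_nonneg _) hq₁ two_ne_zero
  obtain ⟨M, hM⟩ := hU.exists_map_eq_of_norm_le hε hK hq₁
  choose a ha haK haM using fun i : Fin d => hM (Pi.single i ((q : ℚ_[p]) ^ M))
    (by rw [Pi.norm_single, norm_pow])
  refine ⟨d, a, fun i => ⟨haK i, hU.isCompact_topologicalClosure_zpowers (ha i), ?_⟩,
    fun m => Subgroup.isOpen_of_mem_nhds _ (g := 1) ?_⟩
  · refine hU.tendsto_nhds_one hε (fun m => U.pow_mem (ha i) _) (squeeze_zero_norm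
      (fun m => hU.almostAdditiveOn.norm_map_pow_pow_le hq₁ (ha i) m) ?_)
    simpa using (tendsto_pow_atTop_nhds_zero_of_lt_one (norm_nonneg _) hq₁).mul_const ‖φ (a i)‖
  · have hr : 0 < ‖(q : ℚ_[p])‖ := norm_pos_iff.2 (Nat.cast_ne_zero.2 hq)
    have hsmall : ∀ᶠ g in 𝓝 (1 : G), ‖φ g‖ < ‖(q : ℚ_[p])‖ ^ (M + m) :=
      (φ.continuousAt hU.one_mem_source).norm.eventually_lt continuousAt_const
        (by simp [hU.almostAdditiveOn.map_one hε, hr])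
    filter_upwards [hU.mem_nhds_one, hsmall] with g hg hgm
    exact hU.mem_iSup_topologicalClosure_zpowers hq hq₁ ha haM hg hgm.le

end IsStandardSubgroup

section StrictDerivative

variable {𝕜 E F H : Type*} [NontriviallyNormedField 𝕜] [NormedAddCommGroup E] [NormedSpace 𝕜 E]
  [NormedAddCommGroup F] [NormedSpace 𝕜 F] [NormedAddCommGroup H] [NormedSpace 𝕜 H]
  {f : E × F → H} {f' : E × F →L[𝕜] H}

theorem fderiv_eq_zero_of_eventually_eq_zero_on_axes (hf : HasFDerivAt f f' 0)
    (h₁ : ∀ᶠ x in 𝓝 0, f (x, 0) = 0) (h₂ : ∀ᶠ y in 𝓝 0, f (0, y) = 0) : f' = 0 := by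
  have hinl : f' ∘L .inl 𝕜 E F = 0 :=
    (hf.comp (0 : E) (ContinuousLinearMap.inl 𝕜 E F).hasFDerivAt).unique
      ((hasFDerivAt_const 0 0).congr_of_eventuallyEq h₁)
  have hinr : f' ∘L .inr 𝕜 E F = 0 :=
    (hf.comp (0 : F) (ContinuousLinearMap.inr 𝕜 E F).hasFDerivAt).unique
      ((hasFDerivAt_const 0 0).congr_of_eventuallyEq h₂)
  ext x
  · simpa using congr($hinl x)
  · simpa using congr($hinr x)

theorem eventually_norm_le_mul_min_of_eventually_eq_zero_on_axes (hf : HasStrictFDerivAt f f' 0)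
    (h₁ : ∀ᶠ x in 𝓝 0, f (x, 0) = 0) (h₂ : ∀ᶠ y in 𝓝 0, f (0, y) = 0) {ε : ℝ} (hε : 0 < ε) :
    ∀ᶠ z in 𝓝 0, ‖f z‖ ≤ ε * min ‖z.1‖ ‖z.2‖ := by
  rw [fderiv_eq_zero_of_eventually_eq_zero_on_axes hf.hasFDerivAt h₁ h₂] at hf
  have hlip : ∀ᶠ z in 𝓝 ((0 : E × F), (0 : E × F)), ‖f z.1 - f z.2‖ ≤ ε * ‖z.1 - z.2‖ := by
    simpa using hf.isLittleO.bound hε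
  have hfst : Tendsto (fun z : E × F => (z, (z.1, (0 : F)))) (𝓝 0) (𝓝 (0, 0)) :=
    Continuous.tendsto' (by fun_prop) _ _ rfl
  have hsnd : Tendsto (fun z : E × F => (z, ((0 : E), z.2))) (𝓝 0) (𝓝 (0, 0)) :=
    Continuous.tendsto' (by fun_prop) _ _ rfl
  filter_upwards [hfst.eventually hlip, hsnd.eventually hlip,
    continuousAt_fst.eventually h₁, continuousAt_snd.eventually h₂] with z hz₁ hz₂ hf₁ hf₂
  rw [mul_min_of_nonneg _ _ hε.le]
  refine le_min ?_ ?_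
  · simpa [hf₂, Prod.norm_def] using hz₂
  · simpa [hf₁, Prod.norm_def] using hz₁

end StrictDerivative

theorem exists_forall_norm_le_imp_mem {X F : Type*} [TopologicalSpace X]
    [SeminormedAddCommGroup F] {φ : OpenPartialHomeomorph X F} {x : X} (hx : x ∈ φ.source)
    (hφx : φ x = 0) {V : Set X} (hV : V ∈ 𝓝 x) :
    ∃ δ > 0, ∀ y ∈ φ.source, ‖φ y‖ ≤ δ → y ∈ V := by
  have hbasis := ((Metric.nhds_basis_closedBall (x := φ x)).comap φ).inf_principal φ.source
  rw [← φ.nhds_eq_comap_inf_principal hx, hφx] at hbasis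
  obtain ⟨δ, hδ, hsub⟩ := hbasis.mem_iff.1 hV
  exact ⟨δ, hδ, fun y hy hyδ => hsub ⟨mem_closedBall_zero_iff.2 hyδ, hy⟩⟩

theorem exists_isStandardSubgroup {G F : Type*} [Group G] [TopologicalSpace G]
    [IsTopologicalGroup G] [WeaklyLocallyCompactSpace G] [NormedAddCommGroup F]
    [IsUltrametricDist F] {φ : OpenPartialHomeomorph G F} {ε : ℝ} (hφ : 1 ∈ φ.source)
    (hφ₁ : φ 1 = 0) (hε : ε ≤ 1)
    (h : ∀ᶠ z in 𝓝 (1 : G × G), ‖φ (z.1 * z.2) - φ z.1 - φ z.2‖ ≤ ε * min ‖φ z.1‖ ‖φ z.2‖) :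
    ∃ U, IsStandardSubgroup φ U ε := by
  have hsource : φ.source ∈ 𝓝 1 := φ.open_source.mem_nhds hφ
  obtain ⟨K, hKcompact, hK⟩ := exists_compact_mem_nhds (1 : G)
  have hmul : ∀ᶠ z in 𝓝 (1 : G × G), z.1 * z.2 ∈ φ.source :=
    continuous_mul.tendsto' (1 : G × G) 1 (one_mul 1) hsource
  obtain ⟨V, hV, hVV⟩ : ∃ V ∈ 𝓝 (1 : G), V ×ˢ V ⊆ {z | z.1 * z.2 ∈ φ.source ∧
      ‖φ (z.1 * z.2) - φ z.1 - φ z.2‖ ≤ ε * min ‖φ z.1‖ ‖φ z.2‖} := by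
    rw [← mem_prod_self_iff, ← nhds_prod_eq]
    exact hmul.and h
  obtain ⟨δ, hδ, hball⟩ := exists_forall_norm_le_imp_mem hφ hφ₁ (inter_mem hV hK)
  let W : Submonoid G :=
    { carrier := {g | g ∈ φ.source ∧ ‖φ g‖ ≤ δ}
      one_mem' := ⟨hφ, by simp [hφ₁, hδ.le]⟩
      mul_mem' := by
        rintro g h ⟨hg, hgδ⟩ ⟨hh, hhδ⟩
        obtain ⟨hgh, hadd⟩ := hVV (Set.mk_mem_prod (hball g hg hgδ).1 (hball h hh hhδ).1)
        rw [sub_sub] at hadd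
        refine ⟨hgh, norm_le_of_norm_sub_le (hadd.trans ?_)
          (norm_add_le_of_norm_le_of_norm_le hgδ hhδ)⟩
        exact (mul_le_of_le_one_left (by positivity) hε).trans ((min_le_left _ _).trans hgδ) }
  have hW : (W : Set G) ∈ 𝓝 1 := by
    refine inter_mem hsource ((φ.continuousAt hφ).norm.eventually_le_const ?_)
    simpa [hφ₁] using hδ
  have hUW : (W.mulSupport : Set G) ⊆ W := Set.inter_subset_left
  have hUVK : (W.mulSupport : Set G) ⊆ V ∩ K := fun g hg => hball g (hUW hg).1 (hUW hg).2
  have hUopen : IsOpen (W.mulSupport : Set G) :=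
    Subgroup.isOpen_of_mem_nhds _ (g := 1) (inter_mem hW (inv_mem_nhds_one G hW))
  exact ⟨W.mulSupport, hUopen, hKcompact.of_isClosed_subset (Subgroup.isClosed_of_isOpen _ hUopen)
    fun g hg => (hUVK hg).2, fun g hg => (hUW hg).1,
    fun g hg h hh => (hVV (Set.mk_mem_prod (hUVK hg).1 (hUVK hh).1)).2⟩

section LieGroup

variable {𝕜 E F G : Type*} [NontriviallyNormedField 𝕜] [NormedAddCommGroup E] [NormedSpace 𝕜 E]
  [NormedAddCommGroup F] [NormedSpace 𝕜 F] [Group G] [TopologicalSpace G]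

theorem eventually_norm_map_mul_sub_le_of_hasStrictFDerivAt {φ : OpenPartialHomeomorph G F}
    (hφ : 1 ∈ φ.source) (hφ₁ : φ 1 = 0) {μ' : F × F →L[𝕜] F}
    (hμ : HasStrictFDerivAt (fun z : F × F => φ (φ.symm z.1 * φ.symm z.2)) μ' 0) {ε : ℝ}
    (hε : 0 < ε) :
    ∀ᶠ z in 𝓝 (1 : G × G), ‖φ (z.1 * z.2) - φ z.1 - φ z.2‖ ≤ ε * min ‖φ z.1‖ ‖φ z.2‖ := by
  have hsymm : φ.symm 0 = 1 := by rw [← hφ₁, φ.left_inv hφ]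
  have hright : ∀ᶠ x in 𝓝 (0 : F), φ (φ.symm x) = x := by
    simpa only [hφ₁] using φ.eventually_right_inverse' hφ
  have hbound := eventually_norm_le_mul_min_of_eventually_eq_zero_on_axes
    ((hμ.sub hasStrictFDerivAt_fst).sub hasStrictFDerivAt_snd)
    (by simpa [hsymm, sub_eq_zero] using hright) (by simpa [hsymm, sub_eq_zero] using hright) hε
  have hchart : Tendsto (Prod.map φ φ) (𝓝 (1 : G × G)) (𝓝 (0 : F × F)) := by
    have h := (φ.continuousAt hφ).tendsto
    rw [hφ₁] at h
    exact h.prodMap_nhds h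
  filter_upwards [hchart.eventually hbound, (φ.eventually_left_inverse hφ).prodMk_nhds
    (φ.eventually_left_inverse hφ)] with z hz hleft
  simpa [hleft.1, hleft.2] using hz

theorem exists_chart_analyticAt_mul [ChartedSpace E G] [LieGroup 𝓘(𝕜, E) ω G]
    (L : E ≃L[𝕜] F) :
    ∃ φ : OpenPartialHomeomorph G F, 1 ∈ φ.source ∧ φ 1 = 0 ∧
      AnalyticAt 𝕜 (fun z : F × F => φ (φ.symm z.1 * φ.symm z.2)) 0 := by
  set ψ := chartAt E (1 : G)
  refine ⟨ψ.transHomeomorph (L.toHomeomorph.trans (Homeomorph.subRight (L (ψ 1)))),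
    mem_chart_source E (1 : G), sub_self _, ContDiffAt.analyticAt ?_⟩
  have hψ : ContDiffAt 𝕜 ω (fun z : E × E => ψ (ψ.symm z.1 * ψ.symm z.2)) (ψ 1, ψ 1) := by
    have h := (contMDiffAt_iff.1 ((contMDiff_mul 𝓘(𝕜, E) ω (G := G)).contMDiffAt
      (x := ((1 : G), (1 : G))))).2
    simpa [ψ, Function.comp_def, contDiffWithinAt_univ] using! h
  have hφ : ContDiffAt 𝕜 ω (fun z : E × E => L (ψ (ψ.symm z.1 * ψ.symm z.2)) - L (ψ 1))
      (ψ 1, ψ 1) :=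
    (L.contDiff.contDiffAt.comp _ hψ).sub contDiffAt_const
  have hsymm : ContDiffAt 𝕜 ω
      (fun z : F × F => (L.symm (z.1 + L (ψ 1)), L.symm (z.2 + L (ψ 1)))) 0 := by
    fun_prop
  exact ContDiffAt.comp (g := fun z : E × E => L (ψ (ψ.symm z.1 * ψ.symm z.2)) - L (ψ 1)) 0
    (by simpa using hφ) hsymm

end LieGroup

theorem hasProcyclicGenerators_of_lieGroup {p q : ℕ} [Fact p.Prime] (hq : q ≠ 0)
    (hq₁ : ‖(q : ℚ_[p])‖ < 1) (E G : Type*) [NormedAddCommGroup E] [NormedSpace ℚ_[p] E]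
    [FiniteDimensional ℚ_[p] E] [Group G] [TopologicalSpace G] [IsTopologicalGroup G]
    [ChartedSpace E G] [LieGroup 𝓘(ℚ_[p], E) ω G] : HasProcyclicGenerators q G := by
  have : ProperSpace E := FiniteDimensional.proper ℚ_[p] E
  have : LocallyCompactSpace G := ChartedSpace.locallyCompactSpace E G
  let L : E ≃L[ℚ_[p]] (Fin (Module.finrank ℚ_[p] E) → ℚ_[p]) :=
    ContinuousLinearEquiv.ofFinrankEq (by simp)
  obtain ⟨φ, hφ, hφ₁, hμ⟩ := exists_chart_analyticAt_mul (G := G) L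
  have hr : 0 < ‖(q : ℚ_[p])‖ := norm_pos_iff.2 (Nat.cast_ne_zero.2 hq)
  obtain ⟨U, hU⟩ := exists_isStandardSubgroup hφ hφ₁ (pow_le_one₀ hr.le hq₁.le)
    (eventually_norm_map_mul_sub_le_of_hasStrictFDerivAt hφ hφ₁ hμ.hasStrictFDerivAt
      (pow_pos hr 2))
  exact hU.hasProcyclicGenerators hq hq₁

section VectorStabilizer

variable {k G V : Type*} [CommRing k] [Group G] [AddCommGroup V] [Module k V]

/-- The subgroup of all `g` fixing the vector `v` under the representation `ρ`. -/
def vectorStabilizer (ρ : Representation k G V) (v : V) : Subgroup G :=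
  (MulAction.stabilizer (Module.End k V)ˣ v).comap ρ.toHomUnits

variable {ρ : Representation k G V} {v : V}

theorem mem_vectorStabilizer {g : G} : g ∈ vectorStabilizer ρ v ↔ ρ g v = v := Iff.rfl

theorem isSmooth_iff_isOpen_vectorStabilizer [TopologicalSpace G] [IsTopologicalGroup G] :
    ρ.IsSmooth ↔ ∀ v, IsOpen (vectorStabilizer ρ v : Set G) := by
  let _ : TopologicalSpace V := ⊥
  have : DiscreteTopology V := ⟨rfl⟩
  change Continuous (fun x : G × V => ρ x.1 x.2) ↔ _
  rw [continuous_prod_of_discrete_right]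
  simp only [continuous_discrete_rng]
  refine ⟨fun h v => h v v, fun h v w => isOpen_iff_mem_nhds.2 ?_⟩
  rintro g rfl
  have hcoset : (fun x => g⁻¹ * x) ⁻¹' (vectorStabilizer ρ v) ∈ 𝓝 g :=
    ((h v).preimage (continuous_const_mul g⁻¹)).mem_nhds (by simp)
  filter_upwards [hcoset] with x hx
  have hx : ρ (g⁻¹ * x) v = v := hx
  rw [Set.mem_preimage, Set.mem_singleton_iff, ← mul_inv_cancel_left g x, map_mul,
    Module.End.mul_apply, hx]

/- Both sides say that `(ρ y - 1) * (ρ z - 1)` kills `v`. -/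
theorem mem_vectorStabilizer_apply_sub_comm {y z : G} (hyz : Commute y z) :
    y ∈ vectorStabilizer ρ (ρ z v - v) ↔ z ∈ vectorStabilizer ρ (ρ y v - v) := by
  have hcomm : ρ y (ρ z v) = ρ z (ρ y v) := by
    rw [← Module.End.mul_apply, ← map_mul, hyz.eq, map_mul, Module.End.mul_apply]
  rw [mem_vectorStabilizer, mem_vectorStabilizer, map_sub, map_sub, hcomm, sub_eq_iff_eq_add',
    sub_eq_iff_eq_add', add_sub_left_comm]

theorem apply_pow_eq_add_nsmul {y : G} (hy : y ∈ vectorStabilizer ρ (ρ y v - v)) (m : ℕ) :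
    ρ (y ^ m) v = v + m • (ρ y v - v) := by
  induction m with
  | zero => simp
  | succ m ih =>
    rw [pow_succ', map_mul, Module.End.mul_apply, ih, map_add, map_nsmul,
      mem_vectorStabilizer.1 hy, succ_nsmul]
    abel

theorem pow_mem_vectorStabilizer {q : ℕ} (hq : (q : k) = 0) {y : G}
    (hy : y ∈ vectorStabilizer ρ (ρ y v - v)) : y ^ q ∈ vectorStabilizer ρ v := by
  rw [mem_vectorStabilizer, apply_pow_eq_add_nsmul hy, ← Nat.cast_smul_eq_nsmul k, hq, zero_smul,
    add_zero]

end VectorStabilizer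

section Procyclic

variable {G : Type*} [Group G] [TopologicalSpace G] [IsTopologicalGroup G]

theorem topologicalClosure_zpowers_pow_subset [T2Space G] {h : G}
    (hh : IsCompact ((Subgroup.zpowers h).topologicalClosure : Set G)) (q : ℕ) :
    ((Subgroup.zpowers (h ^ q)).topologicalClosure : Set G) ⊆
      (· ^ q) '' ((Subgroup.zpowers h).topologicalClosure : Set G) := by
  refine closure_minimal ?_ (hh.image (continuous_pow q)).isClosed
  rintro _ ⟨m, rfl⟩
  exact ⟨h ^ m, Subgroup.le_topologicalClosure _ ⟨m, rfl⟩, by simp only [← zpow_natCast, zpow_comm]⟩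

theorem commute_of_mem_topologicalClosure_zpowers [T2Space G] {a x y : G}
    (hx : x ∈ (Subgroup.zpowers a).topologicalClosure)
    (hy : y ∈ (Subgroup.zpowers a).topologicalClosure) : Commute x y :=
  have hcomm : ∀ b c : Subgroup.zpowers a, b * c = c * b := fun b c =>
    Subtype.ext (setLike_mul_comm b.2 c.2)
  congrArg Subtype.val
    (((Subgroup.zpowers a).commGroupTopologicalClosure hcomm).mul_comm ⟨x, hx⟩ ⟨y, hy⟩)

variable {k V : Type*} [CommRing k] [AddCommGroup V] [Module k V] {ρ : Representation k G V}
  {v : V}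

theorem topologicalClosure_zpowers_le_vectorStabilizer
    (hv : IsOpen (vectorStabilizer ρ v : Set G)) {g : G} (hg : g ∈ vectorStabilizer ρ v) :
    (Subgroup.zpowers g).topologicalClosure ≤ vectorStabilizer ρ v :=
  Subgroup.topologicalClosure_minimal _ (Subgroup.zpowers_le.2 hg)
    (Subgroup.isClosed_of_isOpen _ hv)

theorem eventually_topologicalClosure_zpowers_pow_le_vectorStabilizer [T2Space G] {q : ℕ}
    (hq : (q : k) = 0) {a : G}
    (hcompact : IsCompact ((Subgroup.zpowers a).topologicalClosure : Set G))
    (hlim : Tendsto (fun m => a ^ q ^ m) atTop (𝓝 1))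
    (hopen : ∀ y ∈ (Subgroup.zpowers a).topologicalClosure,
      IsOpen (vectorStabilizer ρ (ρ y v - v) : Set G)) :
    ∀ᶠ m in atTop,
      (Subgroup.zpowers (a ^ q ^ (m + 1))).topologicalClosure ≤ vectorStabilizer ρ v := by
  set C := (Subgroup.zpowers a).topologicalClosure
  have haC : a ∈ C := Subgroup.le_topologicalClosure _ (Subgroup.mem_zpowers a)
  filter_upwards [hlim.eventually ((hopen a haC).mem_nhds (one_mem _))] with m hm
  set h := a ^ q ^ m
  have hhC : h ∈ C := C.pow_mem haC _
  have hle : (Subgroup.zpowers h).topologicalClosure ≤ C :=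
    Subgroup.topologicalClosure_minimal _ (Subgroup.zpowers_le.2 hhC)
      (Subgroup.isClosed_topologicalClosure _)
  have hfix_h : C ≤ vectorStabilizer ρ (ρ h v - v) :=
    topologicalClosure_zpowers_le_vectorStabilizer (hopen h hhC)
      ((mem_vectorStabilizer_apply_sub_comm
        (commute_of_mem_topologicalClosure_zpowers hhC haC)).1 hm)
  have hfix_self : ∀ y ∈ (Subgroup.zpowers h).topologicalClosure,
      y ∈ vectorStabilizer ρ (ρ y v - v) := fun y hy =>
    topologicalClosure_zpowers_le_vectorStabilizer (hopen y (hle hy))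
      ((mem_vectorStabilizer_apply_sub_comm
        (commute_of_mem_topologicalClosure_zpowers (hle hy) hhC)).1 (hfix_h (hle hy))) hy
  rw [pow_succ, pow_mul]
  intro x hx
  obtain ⟨y, hy, rfl⟩ := topologicalClosure_zpowers_pow_subset
    (hcompact.of_isClosed_subset (Subgroup.isClosed_topologicalClosure _) hle) q hx
  exact pow_mem_vectorStabilizer hq (hfix_self y hy)

theorem HasProcyclicGenerators.isSmooth_of_exact [T2Space G] {q : ℕ}
    (hG : HasProcyclicGenerators q G) {k V₁ V₂ V₃ : Type*} [CommRing k] (hq : (q : k) = 0)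
    [AddCommGroup V₁] [Module k V₁] [AddCommGroup V₂] [Module k V₂] [AddCommGroup V₃] [Module k V₃]
    {ρ₁ : Representation k G V₁} {ρ₂ : Representation k G V₂} {ρ₃ : Representation k G V₃}
    {f : ρ₁.IntertwiningMap ρ₂} {g : ρ₂.IntertwiningMap ρ₃} (hfg : Function.Exact f g)
    (h₁ : ρ₁.IsSmooth) (h₃ : ρ₃.IsSmooth) : ρ₂.IsSmooth := by
  rw [isSmooth_iff_isOpen_vectorStabilizer] at h₁ h₃ ⊢
  intro v
  obtain ⟨d, a, ha, hopen⟩ := hG _ ((h₃ (g v)).mem_nhds (one_mem _))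
  have hcocycle : ∀ y ∈ vectorStabilizer ρ₃ (g v),
      IsOpen (vectorStabilizer ρ₂ (ρ₂ y v - v) : Set G) := fun y hy => by
    obtain ⟨w, hw⟩ := (hfg (ρ₂ y v - v)).1
      (by rw [map_sub, g.isIntertwining, mem_vectorStabilizer.1 hy, sub_self])
    refine Subgroup.isOpen_mono (fun x hx => ?_) (h₁ w)
    rw [mem_vectorStabilizer, ← hw, ← f.isIntertwining, mem_vectorStabilizer.1 hx]
  have hsmall : ∀ᶠ m in atTop, ∀ i,
      (Subgroup.zpowers (a i ^ q ^ (m + 1))).topologicalClosure ≤ vectorStabilizer ρ₂ v :=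
    eventually_all.2 fun i => by
      obtain ⟨haK, hcompact, hlim⟩ := ha i
      exact eventually_topologicalClosure_zpowers_pow_le_vectorStabilizer hq hcompact hlim
        fun y hy => hcocycle y (topologicalClosure_zpowers_le_vectorStabilizer (h₃ (g v)) haK hy)
  obtain ⟨m, hm⟩ := hsmall.exists
  exact Subgroup.isOpen_mono (iSup_le hm) (hopen (m + 1))

end Procyclic

theorem corollary4p4_general (p : ℕ) [Fact p.Prime]
    {E : Type*} [NormedAddCommGroup E] [NormedSpace ℚ_[p] E] [FiniteDimensional ℚ_[p] E]
    {G : Type v} [Group G] [TopologicalSpace G] [ChartedSpace E G] [LieGroup 𝓘(ℚ_[p], E) ω G]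
    {k : Type u} [CommRing k] (hk : 0 < ringChar k)
    (S : CategoryTheory.ShortComplex (Rep.{w} k G)) (hS : S.Exact)
    (h₁ : S.X₁.ρ.IsSmooth) (h₃ : S.X₃.ρ.IsSmooth) :
    S.X₂.ρ.IsSmooth := by
  have : IsTopologicalGroup G := topologicalGroup_of_lieGroup 𝓘(ℚ_[p], E) ω
  have : T1Space G := ChartedSpace.t1Space E G
  have hq : p * ringChar k ≠ 0 := mul_ne_zero (Fact.out : p.Prime).ne_zero hk.ne'
  have hq₁ : ‖((p * ringChar k : ℕ) : ℚ_[p])‖ < 1 :=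
    Padic.norm_natCast_lt_one_iff.2 (dvd_mul_right p _)
  have hrange : LinearMap.range S.f.hom.toLinearMap = LinearMap.ker S.g.hom.toLinearMap :=
    (hS.map (CategoryTheory.forget₂ (Rep k G) (ModuleCat k))).moduleCat_range_eq_ker
  have hexact : Function.Exact S.f.hom S.g.hom := fun x => (SetLike.ext_iff.1 hrange x).symm
  exact (hasProcyclicGenerators_of_lieGroup hq hq₁ E G).isSmooth_of_exact (by simp) hexact h₁ h₃

/-- `G` is a `p`-adic analytic group: a group object in finite-dimensional analytic manifolds over
`ℚ_[p]`, modelled on some finite-dimensional `ℚ_[p]`-vector space `E`. The prime `p` is unrelated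
to the characteristic of `k`. -/
theorem corollary4p4 (p : ℕ) [Fact p.Prime]
    {E : Type*} [NormedAddCommGroup E] [NormedSpace ℚ_[p] E] [FiniteDimensional ℚ_[p] E]
    {G : Type v} [Group G] [TopologicalSpace G] [ChartedSpace E G] [LieGroup 𝓘(ℚ_[p], E) ω G]
    {k : Type u} [Field k] (hk : 0 < ringChar k)
    (S : CategoryTheory.ShortComplex (Rep.{w} k G)) (hS : S.ShortExact)
    (h₁ : S.X₁.ρ.IsSmooth) (h₃ : S.X₃.ρ.IsSmooth) :
    S.X₂.ρ.IsSmooth :=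
  corollary4p4_general p (E := E) hk S hS.exact h₁ h₃
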